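/- Let $\varphi(n)=\#\{1\le k\le n : \gcd(k,n)=1\}$ be Euler's totient function and, for real $x$, let $N^{\times}_{\varphi}(x)$ be the number of positive integers $n\le x$ such that $n=k\varphi(k)$ for some positive integer $k$. The product $$c_0=\prod_p\left(1+\frac{1}{p\left(p-1+\sqrt{p^2-p}\right)}\right)$$ over all primes $p$ converges (unconditionally), its value is $c_0=1.365\ldots$ (that is, $1.365\le c_0<1.366$), and there are absolute constants $c>0$ and $C>0$ such that for all real $x\ge e$ $$\left|N^{\times}_{\varphi}(x)-c_0x^{1/2}\right|\le C\,x^{1/2}\exp\left(-c\sqrt{\log x\,\log\log x}\right).$$ -/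

import Mathlib

noncomputable section

/-- The number of positive integers `n ≤ x` which can be written as `n = k * f k` for some
positive integer `k`. -/
def multCount (f : ℕ → ℕ) (x : ℝ) : ℕ :=
  Set.ncard {n : ℕ | 0 < n ∧ (n : ℝ) ≤ x ∧ ∃ k : ℕ, 0 < k ∧ n = k * f k}

/-- The factor of the constant `c₀` at the prime `p`. -/
def totientFactor (p : Nat.Primes) : ℝ :=
  1 + 1 / ((p : ℝ) * ((p : ℝ) - 1 + Real.sqrt ((p : ℝ) ^ 2 - (p : ℝ))))

/-- The constant `c₀`, a product over all primes. -/
def totientConst : ℝ := ∏' p : Nat.Primes, totientFactor p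

end

/-- The number of positive integers `k` with `k * ∏ h p ≤ Y`, the product being over the `p ∈ S`
which divide `k`. -/
noncomputable def weightedCount (h : ℕ → ℝ) (S : Finset ℕ) (Y : ℝ) : ℕ :=
  Set.ncard {k : ℕ | 0 < k ∧ (k : ℝ) * ∏ p ∈ S, (if p ∣ k then h p else 1) ≤ Y}

theorem weight_pos {h : ℕ → ℝ} (h0 : ∀ p, 0 < h p) (S : Finset ℕ) (k : ℕ) :
    0 < ∏ p ∈ S, (if p ∣ k then h p else 1) :=
  Finset.prod_pos fun p _ => by split_ifs <;> simp [h0]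

theorem finite_weighted {h : ℕ → ℝ} (h0 : ∀ p, 0 < h p) (S : Finset ℕ) (Y : ℝ) :
    {k : ℕ | 0 < k ∧ (k : ℝ) * ∏ p ∈ S, (if p ∣ k then h p else 1) ≤ Y}.Finite := by
  have hm : 0 < ∏ p ∈ S, min (h p) 1 := Finset.prod_pos fun p _ => by simp [h0]
  refine (Set.finite_Iic ⌊Y / ∏ p ∈ S, min (h p) 1⌋₊).subset ?_
  rintro k ⟨_, hk⟩
  refine Nat.le_floor ((le_div_iff₀ hm).2 (le_trans ?_ hk))
  refine mul_le_mul_of_nonneg_left (Finset.prod_le_prod (fun p _ => ?_) fun p _ => ?_)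
    (Nat.cast_nonneg k)
  · exact le_min (h0 p).le zero_le_one
  · split_ifs <;> simp

theorem weightedCount_insert {h : ℕ → ℝ} (h0 : ∀ p, 0 < h p) {S : Finset ℕ}
    (hS : ∀ p ∈ S, p.Prime) {q : ℕ} (hq : q.Prime) (hqS : q ∉ S) (Y : ℝ) :
    weightedCount h (insert q S) Y + weightedCount h S (Y / q) =
      weightedCount h S Y + weightedCount h S (Y / (q * h q)) := by
  have hq0 : (0 : ℝ) < q := by exact_mod_cast hq.pos
  have hw : ∀ k, ∏ p ∈ S, (if p ∣ q * k then h p else 1) = ∏ p ∈ S, (if p ∣ k then h p else 1) := by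
    intro k
    refine Finset.prod_congr rfl fun p hp => ?_
    have : p ∣ q * k ↔ p ∣ k := by
      rw [(hS p hp).dvd_mul, Nat.prime_dvd_prime_iff_eq (hS p hp) hq]
      constructor
      · rintro (rfl | h1)
        · exact absurd hp hqS
        · exact h1
      · exact Or.inr
    simp only [this]
  set w : ℕ → ℝ := fun k => ∏ p ∈ S, (if p ∣ k then h p else 1) with hwdef
  set A : Set ℕ := {k | 0 < k ∧ (k : ℝ) * w k ≤ Y ∧ ¬ q ∣ k} with hA
  have inj : Function.Injective fun k : ℕ => q * k := fun a b hab =>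
    Nat.eq_of_mul_eq_mul_left hq.pos hab
  have key : ∀ c : ℝ, 0 < c → ∀ B : Set ℕ,
      (∀ k, k ∈ B ↔ 0 < k ∧ (k : ℝ) * (w k * if q ∣ k then c else 1) ≤ Y) → B.Finite →
      B.ncard = A.ncard + weightedCount h S (Y / (q * c)) := by
    intro c hc B hB hfin
    have e : B = A ∪ (fun k : ℕ => q * k) '' {k | 0 < k ∧ (k : ℝ) * w k ≤ Y / (q * c)} := by
      ext k
      rw [hB]
      constructor
      · rintro ⟨hk, hk2⟩
        by_cases hd : q ∣ k
        · right
          obtain ⟨m, rfl⟩ := hd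
          refine ⟨m, ⟨Nat.pos_of_mul_pos_left hk, ?_⟩, rfl⟩
          rw [le_div_iff₀ (by positivity)]
          have h3 : w (q * m) = w m := hw m
          rw [if_pos (Dvd.intro m rfl), h3] at hk2
          push_cast at hk2
          linarith
        · left
          rw [if_neg hd, mul_one] at hk2
          exact ⟨hk, hk2, hd⟩
      · rintro (⟨hk, hk2, hd⟩ | ⟨m, ⟨hm, hm2⟩, rfl⟩)
        · rw [if_neg hd, mul_one]
          exact ⟨hk, hk2⟩
        · refine ⟨Nat.mul_pos hq.pos hm, ?_⟩
          have h3 : w (q * m) = w m := hw m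
          show ((q * m : ℕ) : ℝ) * (w (q * m) * if q ∣ q * m then c else 1) ≤ Y
          rw [if_pos (Dvd.intro m rfl), h3]
          rw [le_div_iff₀ (by positivity)] at hm2
          push_cast
          linarith
    have fin1 : A.Finite := hfin.subset (e ▸ Set.subset_union_left)
    have fin2 := hfin.subset (e ▸ Set.subset_union_right (s := A))
    rw [e, Set.ncard_union_eq ?_ fin1 fin2, Set.ncard_image_of_injective _ inj]
    · rfl
    · rw [Set.disjoint_left]
      rintro k ⟨_, _, hd⟩ ⟨m, _, rfl⟩
      exact hd (Dvd.intro m rfl)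
  have e1 := key (h q) (h0 q) _ (fun k => by
    rw [Set.mem_ofPred_eq, Finset.prod_insert hqS, mul_comm (if q ∣ k then h q else 1)])
    (finite_weighted h0 (insert q S) Y)
  have e2 := key 1 one_pos _ (fun k => by
    rw [Set.mem_ofPred_eq, ite_self, mul_one])
    (finite_weighted h0 S Y)
  rw [mul_one] at e2
  have e1' : weightedCount h (insert q S) Y = A.ncard + weightedCount h S (Y / (q * h q)) := e1
  have e2' : weightedCount h S Y = A.ncard + weightedCount h S (Y / q) := e2
  omega

theorem weightedCount_empty (h : ℕ → ℝ) (Y : ℝ) : weightedCount h ∅ Y = ⌊Y⌋₊ := by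
  have : {k : ℕ | 0 < k ∧ (k : ℝ) * ∏ p ∈ (∅ : Finset ℕ), (if p ∣ k then h p else 1) ≤ Y} =
      Finset.Ioc 0 ⌊Y⌋₊ := by
    ext k
    simp only [Finset.prod_empty, mul_one, Set.mem_ofPred_eq, Finset.coe_Ioc, Set.mem_Ioc]
    refine and_congr_right fun hk => (Nat.le_floor_iff' hk.ne').symm
  rw [weightedCount, this, Set.ncard_coe_finset, Nat.card_Ioc, Nat.sub_zero]

theorem abs_floor_sub_le_rpow {Y : ℝ} (hY : 0 < Y) {a : ℝ} (ha0 : 0 ≤ a) (ha1 : a ≤ 1) :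
    |(⌊Y⌋₊ : ℝ) - Y| ≤ Y ^ a := by
  have h1 := Nat.floor_le hY.le
  have h2 := Nat.lt_floor_add_one Y
  rw [abs_sub_comm, abs_of_nonneg (by linarith)]
  rcases le_total 1 Y with hc | hc
  · linarith [Real.one_le_rpow hc ha0]
  · have := Real.rpow_le_rpow_of_exponent_ge hY hc ha1
    rw [Real.rpow_one] at this
    have : (0 : ℝ) ≤ (⌊Y⌋₊ : ℝ) := Nat.cast_nonneg _
    linarith

theorem abs_weightedCount_sub_le {h : ℕ → ℝ} (h0 : ∀ p, 0 < h p) {a : ℝ} (ha0 : 0 ≤ a)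
    (ha1 : a ≤ 1) (S : Finset ℕ) (hS : ∀ p ∈ S, p.Prime) :
    ∀ Y : ℝ, 0 < Y →
    |(weightedCount h S Y : ℝ) - Y * ∏ p ∈ S, (1 - (p : ℝ)⁻¹ + (p * h p)⁻¹)| ≤
      Y ^ a * ∏ p ∈ S, (1 + ((p : ℝ)⁻¹) ^ a + ((p * h p)⁻¹) ^ a) := by
  induction S using Finset.induction_on with
  | empty =>
    intro Y hY
    simpa [weightedCount_empty] using abs_floor_sub_le_rpow hY ha0 ha1
  | insert q S hqS ih =>
    intro Y hY
    have hq := hS q (Finset.mem_insert_self q S)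
    have hS' : ∀ p ∈ S, p.Prime := fun p hp => hS p (Finset.mem_insert_of_mem hp)
    have hq0 : (0 : ℝ) < q := by exact_mod_cast hq.pos
    have hqh : 0 < (q : ℝ) * h q := mul_pos hq0 (h0 q)
    have rec' : (weightedCount h (insert q S) Y : ℝ) + weightedCount h S (Y / q) =
        weightedCount h S Y + weightedCount h S (Y / (q * h q)) := by
      exact_mod_cast weightedCount_insert h0 hS' hq hqS Y
    have i1 := abs_le.1 (ih hS' Y hY)
    have i2 := abs_le.1 (ih hS' (Y / q) (by positivity))
    have i3 := abs_le.1 (ih hS' (Y / (q * h q)) (by positivity))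
    rw [Finset.prod_insert hqS, Finset.prod_insert hqS]
    rw [div_eq_mul_inv, Real.mul_rpow hY.le (by positivity)] at i2 i3
    rw [div_eq_mul_inv, div_eq_mul_inv] at rec'
    generalize (q : ℝ)⁻¹ = u at *
    generalize ((q : ℝ) * h q)⁻¹ = v at *
    rw [abs_le]
    constructor <;> linarith

theorem exists_prime_pow_split {k : ℕ} (hk : 1 < k) :
    ∃ p a m, p.Prime ∧ 0 < m ∧ m < k ∧ ¬ p ∣ m ∧ k = p ^ (a + 1) * m ∧
      ∀ q, q.Prime → q ∣ k → q ≤ p := by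
  have hne : k.primeFactors.Nonempty := Nat.nonempty_primeFactors.2 hk
  obtain ⟨p, hp, hmax⟩ := k.primeFactors.exists_max_image id hne
  have hpp := Nat.prime_of_mem_primeFactors hp
  obtain ⟨e, m, hm, hkm⟩ := Nat.exists_eq_pow_mul_and_not_dvd (by omega : k ≠ 0) p hpp.ne_one
  have he : e ≠ 0 := by
    rintro rfl
    rw [pow_zero, one_mul] at hkm
    exact hm (hkm ▸ Nat.dvd_of_mem_primeFactors hp)
  obtain ⟨a, rfl⟩ := Nat.exists_eq_succ_of_ne_zero he
  have hm0 : 0 < m := Nat.pos_of_ne_zero (by rintro rfl; exact hm (dvd_zero p))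
  refine ⟨p, a, m, hpp, hm0, ?_, hm, hkm, fun q hq hqk => hmax q (Nat.mem_primeFactors.2 ⟨hq, hqk, by omega⟩)⟩
  rw [hkm]
  exact lt_mul_of_one_lt_left hm0 (Nat.one_lt_pow (by omega) hpp.one_lt)

theorem mul_totient_split {p a m : ℕ} (hp : p.Prime) (hm : ¬ p ∣ m) :
    p ^ (a + 1) * m * (p ^ (a + 1) * m).totient =
      p ^ (2 * a + 1) * ((p - 1) * (m * m.totient)) := by
  rw [Nat.totient_mul (((Nat.Prime.coprime_iff_not_dvd hp).2 hm).pow_left _),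
    Nat.totient_prime_pow_succ hp]
  ring

theorem prime_le_of_dvd_mul_totient {k p : ℕ}
    (hmax : ∀ q, q.Prime → q ∣ k → q ≤ p) {q : ℕ} (hq : q.Prime) (hd : q ∣ k * k.totient) :
    q ≤ p := by
  rcases hq.dvd_mul.1 hd with h | h
  · exact hmax q hq h
  have h1 : q ∣ k.totient * ∏ r ∈ k.primeFactors, r := h.mul_right _
  rw [Nat.totient_mul_prod_primeFactors] at h1
  rcases hq.dvd_mul.1 h1 with h2 | h2
  · exact hmax q hq h2
  · obtain ⟨r, hr, hqr⟩ := (hq.prime.dvd_finsetProd_iff _).1 h2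
    have hrp := Nat.prime_of_mem_primeFactors hr
    have := Nat.le_of_dvd (by have := hrp.two_le; omega) hqr
    have := hmax r hrp (Nat.dvd_of_mem_primeFactors hr)
    omega

theorem eq_of_mul_totient_eq (k : ℕ) : ∀ l : ℕ, 0 < k → 0 < l →
    k * k.totient = l * l.totient → k = l := by
  induction k using Nat.strong_induction_on with
  | _ k ih =>
  intro l hk hl h
  by_cases hk1 : k = 1
  · subst hk1
    rw [Nat.totient_one, mul_one] at h
    exact (Nat.eq_one_of_mul_eq_one_right h.symm).symm
  by_cases hl1 : l = 1
  · subst hl1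
    rw [Nat.totient_one, mul_one] at h
    exact Nat.eq_one_of_mul_eq_one_right h
  obtain ⟨p, a, m, hp, hm0, hmk, hpm, rfl, hpmax⟩ := exists_prime_pow_split (by omega : 1 < k)
  obtain ⟨q, b, n, hq, hn0, -, hqn, rfl, hqmax⟩ := exists_prime_pow_split (by omega : 1 < l)
  have hpq : p = q := by
    refine le_antisymm (prime_le_of_dvd_mul_totient hqmax hp ?_)
      (prime_le_of_dvd_mul_totient hpmax hq ?_)
    · rw [← h]
      exact ((dvd_pow_self p (by omega)).mul_right m).mul_right _
    · rw [h]
      exact ((dvd_pow_self q (by omega)).mul_right n).mul_right _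
  subst hpq
  have ndvd : ∀ t, 0 < t → (∀ q, q.Prime → q ∣ t → q ≤ p) → ¬ p ∣ t →
      ¬ p ∣ (p - 1) * (t * t.totient) := by
    intro t ht htm hpt hd
    rcases hp.dvd_mul.1 hd with h1 | h1
    · have := Nat.le_of_dvd (by have := hp.two_le; omega) h1
      have := hp.two_le
      omega
    have h2 : p ∣ t * ∏ r ∈ t.primeFactors, (r - 1) := by
      rcases hp.dvd_mul.1 h1 with h3 | h3
      · exact h3.mul_right _
      · rw [← Nat.totient_mul_prod_primeFactors]
        exact h3.mul_right _
    rcases hp.dvd_mul.1 h2 with h3 | h3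
    · exact hpt h3
    · obtain ⟨r, hr, hpr⟩ := (hp.prime.dvd_finsetProd_iff _).1 h3
      have hrp := Nat.prime_of_mem_primeFactors hr
      have := Nat.le_of_dvd (by have := hrp.two_le; omega) hpr
      have := htm r hrp (Nat.dvd_of_mem_primeFactors hr)
      have := hrp.two_le
      omega
  rw [mul_totient_split hp hpm, mul_totient_split hp hqn] at h
  have hA := ndvd m hm0 (fun q hq hd => hpmax q hq (hd.mul_left _)) hpm
  have hB := ndvd n hn0 (fun q hq hd => hqmax q hq (hd.mul_left _)) hqn
  have hab : a = b := by
    have key : ∀ {i j A B : ℕ}, p ^ i * A = p ^ j * B → ¬ p ∣ A → j ≤ i := by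
      intro i j A B e hA
      have : p ^ j ∣ p ^ i := by
        refine Nat.Coprime.dvd_of_dvd_mul_right
          (((Nat.Prime.coprime_iff_not_dvd hp).2 hA).pow_left j) (e ▸ Dvd.intro B rfl)
      exact (Nat.pow_dvd_pow_iff_le_right hp.one_lt).1 this
    have := key h hA
    have := key h.symm hB
    omega
  subst hab
  have h4 := Nat.eq_of_mul_eq_mul_left (pow_pos hp.pos _) h
  have h5 := Nat.eq_of_mul_eq_mul_left (by have := hp.two_le; omega) h4
  rw [ih m hmk n hm0 hn0 h5]

theorem multCount_totient_eq (x : ℝ) :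
    multCount Nat.totient x =
      Set.ncard {k : ℕ | 0 < k ∧ ((k * k.totient : ℕ) : ℝ) ≤ x} := by
  have : {n : ℕ | 0 < n ∧ (n : ℝ) ≤ x ∧ ∃ k : ℕ, 0 < k ∧ n = k * k.totient} =
      (fun k => k * k.totient) '' {k : ℕ | 0 < k ∧ ((k * k.totient : ℕ) : ℝ) ≤ x} := by
    ext n
    constructor
    · rintro ⟨_, hx, k, hk, rfl⟩
      exact ⟨k, ⟨hk, hx⟩, rfl⟩
    · rintro ⟨k, ⟨hk, hx⟩, rfl⟩
      exact ⟨Nat.mul_pos hk (Nat.totient_pos.2 hk), hx, k, hk, rfl⟩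
  rw [multCount, this]
  exact Set.InjOn.ncard_image fun k hk l hl h => eq_of_mul_totient_eq k l hk.1 hl.1 h

/-- The weight `(φ(p) / p) ^ (1 / 2)` at a prime `p`. -/
noncomputable def totientWeight (p : ℕ) : ℝ :=
  if p.Prime then Real.sqrt (1 - (p : ℝ)⁻¹) else 1

theorem one_sub_inv_prime_pos {p : ℕ} (hp : p.Prime) : 0 < 1 - (p : ℝ)⁻¹ := by
  have : (1 : ℝ) < p := by exact_mod_cast hp.one_lt
  linarith [inv_lt_one_of_one_lt₀ this]

theorem totientWeight_pos (p : ℕ) : 0 < totientWeight p := by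
  unfold totientWeight
  split_ifs with hp
  · exact Real.sqrt_pos.2 (one_sub_inv_prime_pos hp)
  · exact one_pos

theorem totientWeight_le_one (p : ℕ) : totientWeight p ≤ 1 := by
  unfold totientWeight
  split_ifs with hp
  · exact Real.sqrt_le_one.2 (by linarith [inv_nonneg.2 (Nat.cast_nonneg (α := ℝ) p)])
  · exact le_rfl

theorem totientWeight_sq {p : ℕ} (hp : p.Prime) : totientWeight p ^ 2 = 1 - (p : ℝ)⁻¹ := by
  rw [totientWeight, if_pos hp, Real.sq_sqrt (one_sub_inv_prime_pos hp).le]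

theorem one_sub_inv_le_totientWeight {p : ℕ} (hp : p.Prime) :
    1 - (p : ℝ)⁻¹ ≤ totientWeight p := by
  rw [← totientWeight_sq hp, sq]
  exact mul_le_of_le_one_left (totientWeight_pos p).le (totientWeight_le_one p)

theorem mul_totient_eq_sq (k : ℕ) :
    ((k * k.totient : ℕ) : ℝ) = (k * ∏ p ∈ k.primeFactors, totientWeight p) ^ 2 := by
  have h := Nat.totient_eq_mul_prod_factors k
  have h' : (k.totient : ℝ) = k * ∏ p ∈ k.primeFactors, (1 - (p : ℝ)⁻¹) := by
    have h' := congrArg (Rat.cast (K := ℝ)) h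
    push_cast at h'
    exact h'
  rw [Nat.cast_mul, h', mul_pow, ← Finset.prod_pow,
    Finset.prod_congr rfl fun p hp => totientWeight_sq (Nat.prime_of_mem_primeFactors hp)]
  ring

theorem mul_totient_le_iff (k : ℕ) {x : ℝ} (hx : 0 ≤ x) :
    ((k * k.totient : ℕ) : ℝ) ≤ x ↔
      (k : ℝ) * ∏ p ∈ k.primeFactors, totientWeight p ≤ Real.sqrt x := by
  rw [mul_totient_eq_sq, Real.le_sqrt _ hx]
  exact mul_nonneg (Nat.cast_nonneg k) (Finset.prod_nonneg fun p _ => (totientWeight_pos p).le)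

theorem prod_primeFactors_eq_mul {S : Finset ℕ} (hS : ∀ p ∈ S, p.Prime) {k : ℕ} (hk : k ≠ 0) :
    ∏ p ∈ k.primeFactors, totientWeight p =
      (∏ p ∈ S, if p ∣ k then totientWeight p else 1) *
        ∏ p ∈ k.primeFactors \ S, totientWeight p := by
  have : S.filter (· ∣ k) = k.primeFactors ∩ S := by
    ext p
    rw [Finset.mem_filter, Finset.mem_inter, Nat.mem_primeFactors]
    exact ⟨fun h => ⟨⟨hS p h.1, h.2, hk⟩, h.1⟩, fun h => ⟨h.2, h.1.2.1⟩⟩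
  rw [← Finset.prod_filter, this, Finset.prod_inter_mul_prod_sdiff]

theorem one_sub_sum_le_prod_one_sub {ι : Type*} (s : Finset ι) (u : ι → ℝ)
    (h0 : ∀ i ∈ s, 0 ≤ u i) (h1 : ∀ i ∈ s, u i ≤ 1) :
    1 - ∑ i ∈ s, u i ≤ ∏ i ∈ s, (1 - u i) := by
  classical
  induction s using Finset.induction_on with
  | empty => simp
  | insert a s ha ih =>
    have i := ih (fun i hi => h0 i (Finset.mem_insert_of_mem hi))
      fun i hi => h1 i (Finset.mem_insert_of_mem hi)
    have le1 : ∏ i ∈ s, (1 - u i) ≤ 1 := Finset.prod_le_one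
      (fun i hi => sub_nonneg.2 (h1 i (Finset.mem_insert_of_mem hi)))
      fun i hi => sub_le_self _ (h0 i (Finset.mem_insert_of_mem hi))
    rw [Finset.sum_insert ha, Finset.prod_insert ha]
    nlinarith [h0 a (Finset.mem_insert_self a s)]

theorem finite_mul_totient_le (x : ℝ) :
    {k : ℕ | 0 < k ∧ ((k * k.totient : ℕ) : ℝ) ≤ x}.Finite := by
  refine (Set.finite_Iic ⌊x⌋₊).subset fun k ⟨hk, hkx⟩ => Nat.le_floor (le_trans ?_ hkx)
  exact_mod_cast Nat.le_mul_of_pos_right k (Nat.totient_pos.2 hk)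

theorem weightedCount_le_multCount {S : Finset ℕ} (hS : ∀ p ∈ S, p.Prime) {x : ℝ} (hx : 0 ≤ x) :
    weightedCount totientWeight S (Real.sqrt x) ≤ multCount Nat.totient x := by
  rw [multCount_totient_eq]
  refine Set.ncard_le_ncard ?_ (finite_mul_totient_le x)
  rintro k ⟨hk, hkx⟩
  refine ⟨hk, (mul_totient_le_iff k hx).2 (le_trans ?_ hkx)⟩
  rw [prod_primeFactors_eq_mul hS hk.ne', ← mul_assoc]
  exact mul_le_of_le_one_right
    (mul_nonneg (Nat.cast_nonneg k) (weight_pos totientWeight_pos S k).le)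
    (Finset.prod_le_one (fun p _ => (totientWeight_pos p).le) fun p _ => totientWeight_le_one p)

theorem card_primeFactors_le_log {k : ℕ} (hk : k ≠ 0) :
    (k.primeFactors.card : ℝ) ≤ 2 * Real.log k := by
  have h1 : 2 ^ k.primeFactors.card ≤ k := by
    refine le_trans ?_ (Nat.le_of_dvd (Nat.pos_of_ne_zero hk) (Nat.prod_primeFactors_dvd k))
    exact Finset.pow_card_le_prod _ _ _ fun p hp => (Nat.prime_of_mem_primeFactors hp).two_le
  have h2 : (2 : ℝ) ^ k.primeFactors.card ≤ k := by exact_mod_cast h1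
  have h3 := Real.log_le_log (by positivity) h2
  rw [Real.log_pow] at h3
  have := Real.log_two_gt_d9
  nlinarith [Nat.cast_nonneg (α := ℝ) k.primeFactors.card]

theorem multCount_le_weightedCount {z : ℕ} (hz : 0 < z) {x : ℝ} (hx : 0 < x)
    (ht : 2 * Real.log x / z ≤ 1 / 2) :
    multCount Nat.totient x ≤ weightedCount totientWeight {p ∈ Finset.range (z + 1) | p.Prime}
      (Real.sqrt x * (1 + 2 * (2 * Real.log x / z))) := by
  rw [multCount_totient_eq]
  refine Set.ncard_le_ncard ?_ (finite_weighted totientWeight_pos _ _)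
  rintro k ⟨hk, hkx⟩
  refine ⟨hk, ?_⟩
  set S : Finset ℕ := {p ∈ Finset.range (z + 1) | p.Prime} with hSdef
  have hS : ∀ p ∈ S, p.Prime := fun p hp => (Finset.mem_filter.1 hp).2
  set t := 2 * Real.log x / z with htdef
  have hz0 : (0 : ℝ) < z := by exact_mod_cast hz
  have hk0 : (0 : ℝ) < k := by exact_mod_cast hk
  have hkx' : (k : ℝ) ≤ x := le_trans
    (by exact_mod_cast Nat.le_mul_of_pos_right k (Nat.totient_pos.2 hk)) hkx
  have h1 := (mul_totient_le_iff k hx.le).1 hkx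
  rw [prod_primeFactors_eq_mul hS hk.ne', ← mul_assoc] at h1
  have h2 : 1 - t ≤ ∏ p ∈ k.primeFactors \ S, totientWeight p := by
    have hpr : ∀ p ∈ k.primeFactors \ S, p.Prime := fun p hp =>
      Nat.prime_of_mem_primeFactors (Finset.mem_sdiff.1 hp).1
    calc 1 - t ≤ 1 - ∑ p ∈ k.primeFactors \ S, (p : ℝ)⁻¹ := by
          refine sub_le_sub_left ?_ 1
          calc ∑ p ∈ k.primeFactors \ S, (p : ℝ)⁻¹
              ≤ ∑ p ∈ k.primeFactors \ S, (z : ℝ)⁻¹ := by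
                refine Finset.sum_le_sum fun p hp => ?_
                have : z ≤ p := by
                  by_contra! hlt
                  exact (Finset.mem_sdiff.1 hp).2
                    (Finset.mem_filter.2 ⟨Finset.mem_range.2 (by omega), hpr p hp⟩)
                exact inv_anti₀ hz0 (by exact_mod_cast this)
            _ = (k.primeFactors \ S).card * (z : ℝ)⁻¹ := by rw [Finset.sum_const, nsmul_eq_mul]
            _ ≤ (2 * Real.log x) * (z : ℝ)⁻¹ := by
                refine mul_le_mul_of_nonneg_right ?_ (by positivity)
                have a1 : ((k.primeFactors \ S).card : ℝ) ≤ k.primeFactors.card := by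
                  exact_mod_cast Finset.card_le_card Finset.sdiff_subset
                have a2 := card_primeFactors_le_log hk.ne'
                have a3 := Real.log_le_log hk0 hkx'
                linarith
            _ = t := by rw [htdef, div_eq_mul_inv]
      _ ≤ ∏ p ∈ k.primeFactors \ S, (1 - (p : ℝ)⁻¹) :=
          one_sub_sum_le_prod_one_sub _ _ (fun p _ => by positivity)
            fun p hp => by linarith [one_sub_inv_prime_pos (hpr p hp)]
      _ ≤ _ := Finset.prod_le_prod (fun p hp => (one_sub_inv_prime_pos (hpr p hp)).le)
          fun p hp => one_sub_inv_le_totientWeight (hpr p hp)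
  have hw := mul_pos hk0 (weight_pos totientWeight_pos S k)
  set w := (k : ℝ) * ∏ p ∈ S, (if p ∣ k then totientWeight p else 1)
  have hs := Real.sqrt_nonneg x
  have h3 : w * (1 - t) ≤ Real.sqrt x := le_trans (mul_le_mul_of_nonneg_left h2 hw.le) h1
  have ht0 : 0 ≤ t := by
    have : 0 ≤ Real.log x := Real.log_nonneg
      (le_trans (by exact_mod_cast hk) hkx')
    positivity
  have h4 : w * (1 - t) * (1 + 2 * t) ≤ Real.sqrt x * (1 + 2 * t) :=
    mul_le_mul_of_nonneg_right h3 (by linarith)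
  nlinarith [mul_nonneg hw.le (mul_nonneg ht0 (by linarith : 0 ≤ 1 - 2 * t))]

theorem mul_card_primes_dyadic_le (j : ℕ) :
    j * ({p ∈ Finset.Ioc (2 ^ j) (2 ^ (j + 1)) | p.Prime}).card ≤ 2 ^ (j + 2) := by
  set T : Finset ℕ := {p ∈ Finset.Ioc (2 ^ j) (2 ^ (j + 1)) | p.Prime} with hT
  have h1 : (2 ^ j) ^ T.card ≤ ∏ p ∈ T, p := Finset.pow_card_le_prod _ _ _ fun p hp =>
    (Finset.mem_Ioc.1 (Finset.mem_filter.1 hp).1).1.le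
  have h2 : ∏ p ∈ T, p ≤ primorial (2 ^ (j + 1)) := by
    refine Finset.prod_le_prod_of_subset_of_one_le' (fun p hp => ?_) fun p hp _ => ?_
    · have := Finset.mem_filter.1 hp
      exact Finset.mem_filter.2 ⟨Finset.mem_range.2 (by have := Finset.mem_Ioc.1 this.1; omega), this.2⟩
    · exact (Finset.mem_filter.1 hp).2.one_le
  have h3 := (h1.trans h2).trans (primorial_le_four_pow _)
  rw [← pow_mul, show (4 : ℕ) = 2 ^ 2 from rfl, ← pow_mul] at h3
  have h4 := (Nat.pow_le_pow_iff_right (by norm_num)).1 h3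
  calc _ ≤ _ := h4
    _ = _ := by ring

theorem sum_inv_primes_dyadic_le {j : ℕ} (hj : 0 < j) :
    ∑ p ∈ ({p ∈ Finset.Ioc (2 ^ j) (2 ^ (j + 1)) | p.Prime} : Finset ℕ), (p : ℝ)⁻¹ ≤ 4 * (j : ℝ)⁻¹ := by
  have hj0 : (0 : ℝ) < j := by exact_mod_cast hj
  have h2 : ((2 : ℝ) ^ j) ≠ 0 := by positivity
  calc _ ≤ ∑ p ∈ ({p ∈ Finset.Ioc (2 ^ j) (2 ^ (j + 1)) | p.Prime} : Finset ℕ), ((2 : ℝ) ^ j)⁻¹ := by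
        refine Finset.sum_le_sum fun p hp => inv_anti₀ (by positivity) ?_
        exact_mod_cast (Finset.mem_Ioc.1 (Finset.mem_filter.1 hp).1).1.le
    _ = ({p ∈ Finset.Ioc (2 ^ j) (2 ^ (j + 1)) | p.Prime}).card * ((2 : ℝ) ^ j)⁻¹ := by
        rw [Finset.sum_const, nsmul_eq_mul]
    _ ≤ (2 ^ (j + 2) / j) * ((2 : ℝ) ^ j)⁻¹ := by
        refine mul_le_mul_of_nonneg_right ?_ (by positivity)
        rw [le_div_iff₀ hj0, mul_comm]
        exact_mod_cast mul_card_primes_dyadic_le j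
    _ = 4 * (j : ℝ)⁻¹ := by
        rw [pow_add]
        field_simp
        norm_num

theorem sum_inv_primes_two_pow_le (J : ℕ) :
    ∑ p ∈ Finset.range (2 ^ (J + 1) + 1) with p.Prime, (p : ℝ)⁻¹ ≤
      1 / 2 + 4 * ∑ j ∈ Finset.range J, ((j : ℝ) + 1)⁻¹ := by
  induction J with
  | zero =>
    have : {p ∈ Finset.range (2 ^ (0 + 1) + 1) | p.Prime} = {2} := by decide
    rw [this]
    norm_num
  | succ J ih =>
    have hsplit : {p ∈ Finset.range (2 ^ (J + 1 + 1) + 1) | p.Prime} =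
        {p ∈ Finset.range (2 ^ (J + 1) + 1) | p.Prime} ∪
          {p ∈ Finset.Ioc (2 ^ (J + 1)) (2 ^ (J + 1 + 1)) | p.Prime} := by
      have : 2 ^ (J + 1) ≤ 2 ^ (J + 1 + 1) := Nat.pow_le_pow_right (by norm_num) (by omega)
      ext p
      simp only [Finset.mem_filter, Finset.mem_union, Finset.mem_range, Finset.mem_Ioc]
      constructor
      · rintro ⟨h1, h2⟩
        by_cases hc : p < 2 ^ (J + 1) + 1
        · exact Or.inl ⟨hc, h2⟩
        · exact Or.inr ⟨by omega, h2⟩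
      · rintro (⟨h1, h2⟩ | ⟨h1, h2⟩) <;> exact ⟨by omega, h2⟩
    have hd : Disjoint ({p ∈ Finset.range (2 ^ (J + 1) + 1) | p.Prime})
          {p ∈ Finset.Ioc (2 ^ (J + 1)) (2 ^ (J + 1 + 1)) | p.Prime} := by
      rw [Finset.disjoint_left]
      intro p h1 h2
      have := Finset.mem_range.1 (Finset.mem_filter.1 h1).1
      have := Finset.mem_Ioc.1 (Finset.mem_filter.1 h2).1
      omega
    rw [hsplit, Finset.sum_union hd, Finset.sum_range_succ, mul_add]
    have := sum_inv_primes_dyadic_le (j := J + 1) (by omega)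
    push_cast at this
    linarith

theorem sum_inv_primes_le_log {J : ℕ} (hJ : 0 < J) :
    ∑ p ∈ Finset.range (2 ^ J + 1) with p.Prime, (p : ℝ)⁻¹ ≤ 5 + 4 * Real.log J := by
  obtain ⟨K, rfl⟩ := Nat.exists_eq_succ_of_ne_zero hJ.ne'
  have h1 := sum_inv_primes_two_pow_le K
  have h2 := harmonic_le_one_add_log K
  have h3 : ((harmonic K : ℚ) : ℝ) = ∑ j ∈ Finset.range K, ((j : ℝ) + 1)⁻¹ := by
    rw [harmonic]
    push_cast
    rfl
  rw [h3] at h2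
  have h4 : Real.log K ≤ Real.log (K + 1 : ℕ) := by
    rcases Nat.eq_zero_or_pos K with rfl | hK
    · simp
    · exact Real.log_le_log (by exact_mod_cast hK) (by push_cast; linarith)
  rw [Nat.succ_eq_add_one]
  linarith

open Filter Topology in
theorem tendsto_prod_primes {F : ℕ → ℝ} {a : ℝ} (h : HasProd (fun p : Nat.Primes => F p) a) :
    Tendsto (fun n => ∏ p ∈ Finset.range n with p.Prime, F p) atTop (𝓝 a) := by
  have h' : HasProd (F ∘ Subtype.val (p := (· ∈ {x : ℕ | x.Prime}))) a := h
  rw [hasProd_subtype_iff_mulIndicator] at h'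
  refine h'.tendsto_prod_nat.congr fun n => ?_
  rw [Finset.prod_filter]
  exact Finset.prod_congr rfl fun p _ => by
    simp [Set.mulIndicator_apply]

open Filter Topology in
theorem prod_primes_le_of_tendsto {F : ℕ → ℝ} {a : ℝ} (h1 : ∀ p, p.Prime → 1 ≤ F p)
    (h : Tendsto (fun n => ∏ p ∈ Finset.range n with p.Prime, F p) atTop (𝓝 a)) (N : ℕ) :
    ∏ p ∈ Finset.range N with p.Prime, F p ≤ a := by
  refine Monotone.ge_of_tendsto (monotone_nat_of_le_succ fun n => ?_) h N
  rw [Finset.prod_filter, Finset.prod_filter, Finset.prod_range_succ]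
  refine le_mul_of_one_le_right (Finset.prod_nonneg fun p _ => ?_) ?_
  · split_ifs with hp
    · linarith [h1 p hp]
    · exact zero_le_one
  · split_ifs with hp
    · exact h1 n hp
    · exact le_rfl

open Filter Topology in
theorem le_prod_primes_mul_exp_of_tendsto {F : ℕ → ℝ} {a C : ℝ} (hC : 0 ≤ C) {N : ℕ} (hN : 2 ≤ N)
    (h0 : ∀ p, p.Prime → 0 ≤ F p)
    (hF : ∀ p, p.Prime → N ≤ p → F p ≤ 1 + C * (((p : ℝ) - 1)⁻¹ - (p : ℝ)⁻¹))
    (h : Tendsto (fun n => ∏ p ∈ Finset.range n with p.Prime, F p) atTop (𝓝 a)) :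
    a ≤ (∏ p ∈ Finset.range N with p.Prime, F p) * Real.exp (C * ((N : ℝ) - 1)⁻¹) := by
  have hnn : ∀ M, 0 ≤ ∏ p ∈ Finset.range M with p.Prime, F p := fun M =>
    Finset.prod_nonneg fun p hp => h0 p (Finset.mem_filter.1 hp).2
  have key : ∀ M, N ≤ M → ∏ p ∈ Finset.range M with p.Prime, F p ≤
      (∏ p ∈ Finset.range N with p.Prime, F p) *
        Real.exp (C * (((N : ℝ) - 1)⁻¹ - ((M : ℝ) - 1)⁻¹)) := by
    intro M hM
    induction M, hM using Nat.le_induction with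
    | base => simp
    | succ M hM ih =>
      have hM2 : (2 : ℝ) ≤ M := by exact_mod_cast hN.trans hM
      have hd : 0 ≤ ((M : ℝ) - 1)⁻¹ - (M : ℝ)⁻¹ :=
        sub_nonneg.2 (inv_anti₀ (by linarith) (by linarith))
      have hstep : (if M.Prime then F M else 1) ≤
          Real.exp (C * (((M : ℝ) - 1)⁻¹ - (M : ℝ)⁻¹)) := by
        have e := Real.add_one_le_exp (C * (((M : ℝ) - 1)⁻¹ - (M : ℝ)⁻¹))
        split_ifs with hp
        · linarith [hF M hp hM]
        · linarith [mul_nonneg hC hd]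
      have hprod : ∏ p ∈ Finset.range (M + 1) with p.Prime, F p =
          (∏ p ∈ Finset.range M with p.Prime, F p) * (if M.Prime then F M else 1) := by
        rw [Finset.prod_filter, Finset.prod_filter, Finset.prod_range_succ]
      rw [hprod]
      calc _ ≤ (∏ p ∈ Finset.range M with p.Prime, F p) *
              Real.exp (C * (((M : ℝ) - 1)⁻¹ - (M : ℝ)⁻¹)) :=
            mul_le_mul_of_nonneg_left hstep (hnn M)
        _ ≤ _ := mul_le_mul_of_nonneg_right ih (Real.exp_pos _).le
        _ = _ := by
            rw [mul_assoc, ← Real.exp_add]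
            congr 2
            push_cast
            ring
  refine le_of_tendsto h ?_
  filter_upwards [eventually_ge_atTop N] with M hM
  refine (key M hM).trans (mul_le_mul_of_nonneg_left (Real.exp_le_exp.2 ?_) (hnn N))
  refine mul_le_mul_of_nonneg_left ?_ hC
  have hM2 : (2 : ℝ) ≤ M := by exact_mod_cast hN.trans hM
  have : 0 ≤ ((M : ℝ) - 1)⁻¹ := inv_nonneg.2 (by linarith)
  linarith

/-- The Euler factor at `p` in the form in which it comes out of the counting argument. -/
noncomputable def eulerFactor (p : ℕ) : ℝ := 1 - (p : ℝ)⁻¹ + (p * totientWeight p)⁻¹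

theorem mul_totientWeight {p : ℕ} (hp : p.Prime) :
    (p : ℝ) * totientWeight p = Real.sqrt ((p : ℝ) ^ 2 - p) := by
  have hp0 : (0 : ℝ) < p := by exact_mod_cast hp.pos
  symm
  rw [Real.sqrt_eq_iff_mul_self_eq_of_pos (mul_pos hp0 (totientWeight_pos p))]
  have := totientWeight_sq hp
  calc _ = (p : ℝ) ^ 2 * totientWeight p ^ 2 := by ring
    _ = _ := by rw [this]; field_simp

theorem totientFactor_eq (p : Nat.Primes) : totientFactor p = eulerFactor p := by
  have hp2 : (2 : ℝ) ≤ (p : ℕ) := by exact_mod_cast p.2.two_le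
  rw [totientFactor, eulerFactor, mul_totientWeight p.2]
  have hq : 0 < ((p : ℕ) : ℝ) ^ 2 - (p : ℕ) := by nlinarith
  have hr := Real.sqrt_pos.2 hq
  have hr2 := Real.sq_sqrt hq.le
  set r := Real.sqrt (((p : ℕ) : ℝ) ^ 2 - (p : ℕ))
  have : 0 < ((p : ℕ) : ℝ) - 1 + r := by linarith
  field_simp
  linear_combination hr2

theorem one_le_totientFactor (p : Nat.Primes) : 1 ≤ totientFactor p := by
  have hp2 : (2 : ℝ) ≤ (p : ℕ) := by exact_mod_cast p.2.two_le
  have : 0 ≤ 1 / (((p : ℕ) : ℝ) * (((p : ℕ) : ℝ) - 1 +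
      Real.sqrt (((p : ℕ) : ℝ) ^ 2 - (p : ℕ)))) :=
    div_nonneg zero_le_one (mul_nonneg (by linarith)
      (add_nonneg (by linarith) (Real.sqrt_nonneg _)))
  rw [totientFactor]
  linarith

theorem totientFactor_le (p : Nat.Primes) :
    totientFactor p ≤ 1 + 1 * ((((p : ℕ) : ℝ) - 1)⁻¹ - ((p : ℕ) : ℝ)⁻¹) := by
  have hp2 : (2 : ℝ) ≤ (p : ℕ) := by exact_mod_cast p.2.two_le
  have hp1 : (0 : ℝ) < ((p : ℕ) : ℝ) - 1 := by linarith
  have e : 1 * ((((p : ℕ) : ℝ) - 1)⁻¹ - ((p : ℕ) : ℝ)⁻¹) =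
      1 / (((p : ℕ) : ℝ) * (((p : ℕ) : ℝ) - 1)) := by
    field_simp
    ring
  rw [e, totientFactor]
  refine add_le_add_right (one_div_le_one_div_of_le (by positivity) ?_) 1
  exact mul_le_mul_of_nonneg_left (le_add_of_nonneg_right (Real.sqrt_nonneg _)) (by linarith)

theorem multipliable_totientFactor : Multipliable totientFactor := by
  have hs : Summable fun p : Nat.Primes => 2 * (1 / (((p : ℕ) : ℝ) ^ 2)) :=
    (((Real.summable_one_div_nat_pow.2 (by norm_num : 1 < 2)).comp_injective
      Nat.Primes.coe_nat_injective).mul_left 2)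
  have hs' : Summable fun p : Nat.Primes => totientFactor p - 1 := by
    refine hs.of_nonneg_of_le (fun p => sub_nonneg.2 (one_le_totientFactor p)) fun p => ?_
    have hp2 : (2 : ℝ) ≤ (p : ℕ) := by exact_mod_cast p.2.two_le
    have hp1 : (0 : ℝ) < ((p : ℕ) : ℝ) - 1 := by linarith
    have h1 := totientFactor_le p
    have h2 : 1 * ((((p : ℕ) : ℝ) - 1)⁻¹ - ((p : ℕ) : ℝ)⁻¹) ≤ 2 * (1 / (((p : ℕ) : ℝ) ^ 2)) := by
      have e : 1 * ((((p : ℕ) : ℝ) - 1)⁻¹ - ((p : ℕ) : ℝ)⁻¹) =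
          1 / (((p : ℕ) : ℝ) * (((p : ℕ) : ℝ) - 1)) := by
        field_simp
        ring
      rw [e, ← mul_div_assoc, mul_one, div_le_div_iff₀ (by positivity) (by positivity)]
      nlinarith
    linarith
  simpa using Real.multipliable_one_add_of_summable hs'

open Filter Topology in
theorem tendsto_prod_eulerFactor :
    Tendsto (fun n => ∏ p ∈ Finset.range n with p.Prime, eulerFactor p) atTop
      (𝓝 totientConst) := by
  refine tendsto_prod_primes ?_
  have h := multipliable_totientFactor.hasProd
  exact (funext totientFactor_eq : totientFactor = fun p : Nat.Primes => eulerFactor p) ▸ h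

theorem one_le_eulerFactor {p : ℕ} (hp : p.Prime) : 1 ≤ eulerFactor p :=
  totientFactor_eq ⟨p, hp⟩ ▸ one_le_totientFactor ⟨p, hp⟩

theorem prod_eulerFactor_le (N : ℕ) :
    ∏ p ∈ Finset.range N with p.Prime, eulerFactor p ≤ totientConst :=
  prod_primes_le_of_tendsto (fun _ => one_le_eulerFactor) tendsto_prod_eulerFactor N

theorem totientConst_le_prod_mul_exp {z : ℕ} (hz : 1 ≤ z) :
    totientConst ≤ (∏ p ∈ Finset.range (z + 1) with p.Prime, eulerFactor p) *
      Real.exp ((z : ℝ)⁻¹) := by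
  have := le_prod_primes_mul_exp_of_tendsto zero_le_one (N := z + 1) (by omega)
    (fun p hp => zero_le_one.trans (one_le_eulerFactor hp))
    (fun p hp _ => totientFactor_eq ⟨p, hp⟩ ▸ totientFactor_le ⟨p, hp⟩) tendsto_prod_eulerFactor
  simpa using this

open Filter Topology in
theorem tendsto_prod_zeta_two :
    Tendsto (fun n => ∏ p ∈ Finset.range n with p.Prime, (1 - ((p : ℝ) ^ 2)⁻¹)⁻¹) atTop
      (𝓝 (Real.pi ^ 2 / 6)) := by
  let f : ℕ →*₀ ℝ :=
    { toFun := fun n => ((n : ℝ) ^ 2)⁻¹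
      map_zero' := by simp
      map_one' := by simp
      map_mul' := fun a b => by push_cast; rw [mul_pow, mul_inv] }
  have hz : HasSum (fun n : ℕ => f n) (Real.pi ^ 2 / 6) := by
    simpa [f] using hasSum_zeta_two
  have h := EulerProduct.eulerProduct_completely_multiplicative_hasProd (f := f)
    hz.summable.norm
  rw [hz.tsum_eq] at h
  exact tendsto_prod_primes (F := fun p => (1 - ((p : ℝ) ^ 2)⁻¹)⁻¹) h

/-- The factors of `totientConst ^ 2 / ζ(2)`. -/
noncomputable def accelFactor (p : ℕ) : ℝ := eulerFactor p ^ 2 * (1 - ((p : ℝ) ^ 2)⁻¹)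

open Filter Topology in
theorem tendsto_prod_accelFactor :
    Tendsto (fun n => ∏ p ∈ Finset.range n with p.Prime, accelFactor p) atTop
      (𝓝 (totientConst ^ 2 / (Real.pi ^ 2 / 6))) := by
  refine ((tendsto_prod_eulerFactor.pow 2).div tendsto_prod_zeta_two (by positivity)).congr
    fun n => ?_
  simp [accelFactor, Finset.prod_mul_distrib, Finset.prod_pow]

theorem eulerFactor_eq_add_mul {p : ℕ} (hp : p.Prime) :
    ∃ w : ℝ, 0 < w ∧ w ^ 2 * (1 - (p : ℝ)⁻¹) = 1 ∧
      eulerFactor p = 1 - (p : ℝ)⁻¹ + (p : ℝ)⁻¹ * w := by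
  have hw := totientWeight_pos p
  refine ⟨(totientWeight p)⁻¹, inv_pos.2 hw, ?_, by rw [eulerFactor, mul_inv]⟩
  rw [← totientWeight_sq hp]
  field_simp

theorem one_le_accelFactor {p : ℕ} (hp : p.Prime) : 1 ≤ accelFactor p := by
  obtain ⟨w, hw, hw2, hf⟩ := eulerFactor_eq_add_mul hp
  have hp2 : (2 : ℝ) ≤ p := by exact_mod_cast hp.two_le
  rw [accelFactor, hf, ← inv_pow]
  have hu0 : 0 < (p : ℝ)⁻¹ := by positivity
  have hu1 : (p : ℝ)⁻¹ ≤ 1 / 2 := by rw [one_div]; exact inv_anti₀ two_pos hp2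
  generalize (p : ℝ)⁻¹ = u at *
  have h1 : 1 + u / 2 + 3 * u ^ 2 / 8 ≤ w := by
    refine le_of_pow_le_pow_left₀ two_ne_zero hw.le ?_
    refine le_of_mul_le_mul_right ?_ (by linarith : 0 < 1 - u)
    rw [hw2]
    nlinarith [pow_pos hu0 3, pow_pos hu0 4, pow_pos hu0 5]
  have h2 : 1 + u ^ 2 / 2 + 3 * u ^ 3 / 8 ≤ 1 - u + u * w := by nlinarith
  have h3 : (1 + u ^ 2 / 2 + 3 * u ^ 3 / 8) ^ 2 ≤ (1 - u + u * w) ^ 2 :=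
    pow_le_pow_left₀ (by positivity) h2 2
  have h4 : 0 ≤ 1 - u ^ 2 := by nlinarith
  have h5 : 1 ≤ (1 + u ^ 2 / 2 + 3 * u ^ 3 / 8) ^ 2 * (1 - u ^ 2) := by
    have a3 := pow_pos hu0 3
    have a4 : u ^ 4 ≤ u ^ 3 / 2 := by nlinarith
    have a5 : u ^ 5 ≤ u ^ 3 / 4 := by nlinarith
    have a6 : u ^ 6 ≤ u ^ 3 / 8 := by nlinarith
    have a7 : u ^ 7 ≤ u ^ 3 / 16 := by nlinarith
    have a8 : u ^ 8 ≤ u ^ 3 / 32 := by nlinarith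
    nlinarith [pow_pos hu0 4, pow_pos hu0 5, pow_pos hu0 6]
  exact h5.trans (mul_le_mul_of_nonneg_right h3 h4)

theorem accelFactor_le {p : ℕ} (hp : p.Prime) (hp4 : 4 ≤ p) :
    accelFactor p ≤ 1 + ((p : ℝ)⁻¹) ^ 3 := by
  obtain ⟨w, hw, hw2, hf⟩ := eulerFactor_eq_add_mul hp
  have hp4' : (4 : ℝ) ≤ p := by exact_mod_cast hp4
  rw [accelFactor, hf, ← inv_pow]
  have hu0 : 0 < (p : ℝ)⁻¹ := by positivity
  have hu1 : (p : ℝ)⁻¹ ≤ 1 / 4 := by rw [one_div]; exact inv_anti₀ four_pos hp4'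
  generalize (p : ℝ)⁻¹ = u at *
  have h1 : w ≤ 1 + u / 2 + u ^ 2 / 2 := by
    refine le_of_pow_le_pow_left₀ two_ne_zero (by positivity) ?_
    refine le_of_mul_le_mul_right ?_ (by linarith : 0 < 1 - u)
    rw [hw2]
    have a3 : u ^ 3 ≤ u ^ 2 / 4 := by nlinarith [pow_pos hu0 2]
    have a4 : u ^ 4 ≤ u ^ 2 / 16 := by nlinarith [pow_pos hu0 2]
    have a5 : u ^ 5 ≤ u ^ 2 / 64 := by nlinarith [pow_pos hu0 2]
    nlinarith [pow_pos hu0 2]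
  have h2 : 1 - u + u * w ≤ 1 + u ^ 2 / 2 + u ^ 3 / 2 := by nlinarith
  have h3 : (1 - u + u * w) ^ 2 ≤ (1 + u ^ 2 / 2 + u ^ 3 / 2) ^ 2 :=
    pow_le_pow_left₀ (by nlinarith [mul_pos hu0 hw]) h2 2
  have h4 : 0 ≤ 1 - u ^ 2 := by nlinarith
  refine (mul_le_mul_of_nonneg_right h3 h4).trans ?_
  have a4 := pow_pos hu0 4
  have a5 : u ^ 5 ≤ u ^ 4 / 4 := by nlinarith
  have a6 : u ^ 6 ≤ u ^ 4 / 16 := by nlinarith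
  nlinarith [pow_pos hu0 5, pow_pos hu0 6, pow_pos hu0 7, pow_pos hu0 8]

theorem filter_prime_range_thirtySeven :
    {p ∈ Finset.range 37 | p.Prime} = {2, 3, 5, 7, 11, 13, 17, 19, 23, 29, 31} := by
  decide

/-- One step of Newton's method for the square root of `p ^ 2 - p`. -/
noncomputable def newtonStep (p r : ℝ) : ℝ := (r + (p ^ 2 - p) / r) / 2

theorem sqrt_le_newtonStep {p r : ℝ} (hr : 0 < r) (hp : 0 ≤ p ^ 2 - p) :
    Real.sqrt (p ^ 2 - p) ≤ newtonStep p r := by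
  have hs := Real.sq_sqrt hp
  set s := Real.sqrt (p ^ 2 - p)
  rw [newtonStep, ← hs, le_div_iff₀ two_pos]
  have : r + s ^ 2 / r - s * 2 = (r - s) ^ 2 / r := by field_simp; ring
  have : 0 ≤ (r - s) ^ 2 / r := by positivity
  linarith

theorem accelFactor_mem_Icc {p : ℕ} (hp : p.Prime) {r : ℝ}
    (hr : r = newtonStep p (newtonStep p (p - 1 / 2))) :
    (1 - (p : ℝ)⁻¹ + r⁻¹) ^ 2 * (1 - ((p : ℝ) ^ 2)⁻¹) ≤ accelFactor p ∧
    accelFactor p ≤ (1 - (p : ℝ)⁻¹ + r / ((p : ℝ) ^ 2 - p)) ^ 2 * (1 - ((p : ℝ) ^ 2)⁻¹) := by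
  have hp2 : (2 : ℝ) ≤ p := by exact_mod_cast hp.two_le
  have hq : 0 < (p : ℝ) ^ 2 - p := by nlinarith
  have hA : 0 < (p : ℝ) - 1 / 2 := by linarith
  have h1 : 0 < newtonStep p (p - 1 / 2) := by unfold newtonStep; positivity
  have h2 : Real.sqrt ((p : ℝ) ^ 2 - p) ≤ r := hr ▸ sqrt_le_newtonStep h1 hq.le
  have hs := Real.sq_sqrt hq.le
  have hs0 := Real.sqrt_pos.2 hq
  have hu := one_sub_inv_prime_pos hp
  have hu2 : 0 ≤ 1 - ((p : ℝ) ^ 2)⁻¹ := sub_nonneg.2 (inv_le_one_of_one_le₀ (by nlinarith))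
  rw [accelFactor, eulerFactor, mul_totientWeight hp]
  set s := Real.sqrt ((p : ℝ) ^ 2 - p)
  have hr0 : 0 < r := hs0.trans_le h2
  have h3 : s⁻¹ ≤ r / ((p : ℝ) ^ 2 - p) := by
    rw [← hs, inv_eq_one_div, div_le_div_iff₀ hs0 (by positivity)]
    nlinarith
  constructor
  · refine mul_le_mul_of_nonneg_right (pow_le_pow_left₀ (by positivity) ?_ 2) hu2
    exact add_le_add_right (inv_anti₀ hs0 h2) _
  · refine mul_le_mul_of_nonneg_right (pow_le_pow_left₀ (by positivity) ?_ 2) hu2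
    exact add_le_add_right h3 _

theorem prod_accelFactor_bounds :
    1.1328 ≤ ∏ p ∈ Finset.range 37 with p.Prime, accelFactor p ∧
      ∏ p ∈ Finset.range 37 with p.Prime, accelFactor p ≤ 1.1329 := by
  have hpr : ∀ p ∈ ({p ∈ Finset.range 37 | p.Prime} : Finset ℕ), p.Prime := fun p hp =>
    (Finset.mem_filter.1 hp).2
  constructor
  · refine le_trans ?_ (Finset.prod_le_prod (fun p hp => ?_) fun p hp =>
      (accelFactor_mem_Icc (hpr p hp) rfl).1)
    · rw [filter_prime_range_thirtySeven]
      norm_num [newtonStep]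
    · have hp2 : (2 : ℝ) ≤ p := by exact_mod_cast (hpr p hp).two_le
      exact mul_nonneg (sq_nonneg _) (sub_nonneg.2 (inv_le_one_of_one_le₀ (by nlinarith)))
  · refine le_trans (Finset.prod_le_prod (fun p hp => ?_) fun p hp =>
      (accelFactor_mem_Icc (hpr p hp) rfl).2) ?_
    · exact zero_le_one.trans (one_le_accelFactor (hpr p hp))
    · rw [filter_prime_range_thirtySeven]
      norm_num [newtonStep]

theorem totientConst_pos : 0 < totientConst := by
  have := prod_eulerFactor_le 0
  simp at this
  linarith

theorem totientConst_bounds : 1.365 ≤ totientConst ∧ totientConst < 1.366 := by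
  have hlo := prod_primes_le_of_tendsto (fun _ => one_le_accelFactor) tendsto_prod_accelFactor 37
  have hhi := le_prod_primes_mul_exp_of_tendsto (C := 1 / 37) (by norm_num) (N := 37) (by norm_num)
    (fun p hp => zero_le_one.trans (one_le_accelFactor hp)) (fun p hp h37 => by
      refine (accelFactor_le hp (by omega)).trans (add_le_add_right ?_ 1)
      have h : (37 : ℝ) ≤ p := by exact_mod_cast h37
      have e : ((p : ℝ) - 1)⁻¹ - (p : ℝ)⁻¹ = 1 / (p * (p - 1)) := by
        have : (p : ℝ) - 1 ≠ 0 := by linarith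
        field_simp
        ring
      have hp1 : 0 < (p : ℝ) * (p - 1) := mul_pos (by linarith) (by linarith)
      have hp3 : 0 < (p : ℝ) ^ 3 := pow_pos (by linarith) 3
      rw [e, div_mul_div_comm, inv_pow, inv_eq_one_div, div_le_div_iff₀ hp3 (by linarith)]
      nlinarith [mul_nonneg (by linarith : (0 : ℝ) ≤ p)
        (mul_nonneg (by linarith : (0 : ℝ) ≤ p) (by linarith : (0 : ℝ) ≤ p - 37))])
    tendsto_prod_accelFactor
  obtain ⟨b1, b2⟩ := prod_accelFactor_bounds
  have hpi1 := Real.pi_gt_d6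
  have hpi2 := Real.pi_lt_d6
  have hc := totientConst_pos
  have hexp : Real.exp (1 / 37 * (((37 : ℕ) : ℝ) - 1)⁻¹) ≤ 1.00076 := by
    have := Real.exp_bound_div_one_sub_of_interval (x := 1 / 37 * (((37 : ℕ) : ℝ) - 1)⁻¹)
      (by norm_num) (by norm_num)
    refine this.trans ?_
    norm_num
  have hpp : 0 < Real.pi ^ 2 / 6 := by positivity
  constructor
  · refine le_of_pow_le_pow_left₀ two_ne_zero hc.le ?_
    have := (le_div_iff₀ hpp).1 (b1.trans hlo)
    nlinarith
  · refine lt_of_pow_lt_pow_left₀ 2 (by norm_num) ?_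
    have h1 : totientConst ^ 2 / (Real.pi ^ 2 / 6) ≤ 1.1329 * 1.00076 :=
      hhi.trans (mul_le_mul b2 hexp (Real.exp_pos _).le (by norm_num))
    have := (div_le_iff₀ hpp).1 h1
    nlinarith

theorem half_le_totientWeight (p : ℕ) : 1 / 2 ≤ totientWeight p := by
  by_cases hp : p.Prime
  · refine le_trans ?_ (one_sub_inv_le_totientWeight hp)
    have : (2 : ℝ) ≤ p := by exact_mod_cast hp.two_le
    have : (p : ℝ)⁻¹ ≤ 1 / 2 := by rw [one_div]; exact inv_anti₀ two_pos this
    linarith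
  · rw [totientWeight, if_neg hp]
    norm_num

theorem prod_error_le {J : ℕ} (hJ : 0 < J) {η : ℝ} (h0 : 0 ≤ η) (h1 : η ≤ 1) :
    ∏ p ∈ Finset.range (2 ^ J + 1) with p.Prime,
        (1 + ((p : ℝ)⁻¹) ^ (1 - η) + ((p * totientWeight p)⁻¹) ^ (1 - η)) ≤
      Real.exp (3 * ((2 : ℝ) ^ J) ^ η * (5 + 4 * Real.log J)) := by
  have hterm : ∀ p ∈ ({p ∈ Finset.range (2 ^ J + 1) | p.Prime} : Finset ℕ),
      1 + ((p : ℝ)⁻¹) ^ (1 - η) + ((p * totientWeight p)⁻¹) ^ (1 - η) ≤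
        Real.exp (3 * ((2 : ℝ) ^ J) ^ η * (p : ℝ)⁻¹) := by
    intro p hp
    obtain ⟨hpr, hp⟩ := Finset.mem_filter.1 hp
    have hp0 : (0 : ℝ) < p := by exact_mod_cast hp.pos
    have hpJ : (p : ℝ) ≤ 2 ^ J := by
      have := Finset.mem_range.1 hpr
      exact_mod_cast (by omega : p ≤ 2 ^ J)
    have hw := totientWeight_pos p
    have e1 : ((p : ℝ)⁻¹) ^ (1 - η) ≤ ((2 : ℝ) ^ J) ^ η * (p : ℝ)⁻¹ := by
      rw [Real.inv_rpow hp0.le, ← Real.rpow_neg hp0.le, neg_sub, Real.rpow_sub hp0,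
        Real.rpow_one, div_eq_mul_inv]
      exact mul_le_mul_of_nonneg_right (Real.rpow_le_rpow hp0.le hpJ h0) (by positivity)
    have e2 : ((p * totientWeight p)⁻¹) ^ (1 - η) ≤ 2 * ((p : ℝ)⁻¹) ^ (1 - η) := by
      have hw2 : (totientWeight p)⁻¹ ≤ 2 := by
        have := inv_anti₀ (by norm_num : (0 : ℝ) < 1 / 2) (half_le_totientWeight p)
        linarith
      rw [mul_inv, Real.mul_rpow (by positivity) (by positivity), mul_comm]
      refine mul_le_mul_of_nonneg_right ?_ (by positivity)
      calc ((totientWeight p)⁻¹) ^ (1 - η) ≤ (2 : ℝ) ^ (1 - η) :=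
            Real.rpow_le_rpow (by positivity) hw2 (by linarith)
        _ ≤ (2 : ℝ) ^ (1 : ℝ) := Real.rpow_le_rpow_of_exponent_le one_le_two (by linarith)
        _ = 2 := Real.rpow_one 2
    have e3 := Real.add_one_le_exp (3 * ((2 : ℝ) ^ J) ^ η * (p : ℝ)⁻¹)
    linarith
  have hw := fun p => totientWeight_pos p
  refine (Finset.prod_le_prod (fun p _ => by have := hw p; positivity) hterm).trans ?_
  rw [← Real.exp_sum, ← Finset.mul_sum]
  exact Real.exp_le_exp.2 (mul_le_mul_of_nonneg_left (sum_inv_primes_le_log hJ) (by positivity))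

theorem abs_multCount_sub_le {x : ℝ} (hx : Real.exp 1 ≤ x) {J : ℕ} (hJ : 0 < J)
    (ht : 2 * Real.log x / 2 ^ J ≤ 1 / 2) {η : ℝ} (h0 : 0 ≤ η) (h1 : η ≤ 1) :
    |(multCount Nat.totient x : ℝ) - totientConst * Real.sqrt x| ≤
      Real.sqrt x * (4 * totientConst * (2 * Real.log x / 2 ^ J) +
        2 * Real.exp (3 * ((2 : ℝ) ^ J) ^ η * (5 + 4 * Real.log J) - η / 2 * Real.log x)) := by
  have hx0 : 0 < x := (Real.exp_pos 1).trans_le hx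
  have hL : 1 ≤ Real.log x := (Real.le_log_iff_exp_le hx0).2 hx
  have hz1 : (1 : ℝ) ≤ 2 ^ J := one_le_pow₀ one_le_two
  set t := 2 * Real.log x / 2 ^ J with htdef
  have htz : ((2 : ℝ) ^ J)⁻¹ ≤ t := by
    rw [htdef, div_eq_mul_inv]
    exact le_mul_of_one_le_left (by positivity) (by linarith)
  have hzpos : 0 < ((2 : ℝ) ^ J)⁻¹ := by positivity
  set Y := Real.sqrt x with hY
  have hY0 : 0 < Y := Real.sqrt_pos.2 hx0
  set S : Finset ℕ := {p ∈ Finset.range (2 ^ J + 1) | p.Prime} with hSdef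
  have hS : ∀ p ∈ S, p.Prime := fun p hp => (Finset.mem_filter.1 hp).2
  have lower : (weightedCount totientWeight S Y : ℝ) ≤ multCount Nat.totient x := by
    exact_mod_cast weightedCount_le_multCount hS hx0.le
  have upper : (multCount Nat.totient x : ℝ) ≤
      weightedCount totientWeight S (Y * (1 + 2 * t)) := by
    have := Nat.cast_le (α := ℝ).2
      (multCount_le_weightedCount (z := 2 ^ J) (by positivity) hx0 (by push_cast; exact ht))
    rwa [Nat.cast_pow, Nat.cast_ofNat] at this
  have a1 := abs_le.1 (abs_weightedCount_sub_le totientWeight_pos (a := 1 - η) (by linarith)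
    (by linarith) S hS Y hY0)
  have a2 := abs_le.1 (abs_weightedCount_sub_le totientWeight_pos (a := 1 - η) (by linarith)
    (by linarith) S hS (Y * (1 + 2 * t)) (by positivity))
  have hE := prod_error_le hJ h0 h1
  have hP1 := prod_eulerFactor_le (2 ^ J + 1)
  have hP2 := totientConst_le_prod_mul_exp (z := 2 ^ J) Nat.one_le_two_pow
  push_cast at hP2
  have hPdef : ∏ p ∈ S, (1 - (p : ℝ)⁻¹ + (p * totientWeight p)⁻¹) = ∏ p ∈ S, eulerFactor p := rfl
  rw [hPdef] at a1 a2
  have hc := totientConst_pos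
  have hP0 : 0 ≤ ∏ p ∈ S, eulerFactor p :=
    Finset.prod_nonneg fun p hp => zero_le_one.trans (one_le_eulerFactor (hS p hp))
  have hw := fun p => totientWeight_pos p
  have hE0 : 0 ≤ ∏ p ∈ S,
      (1 + ((p : ℝ)⁻¹) ^ (1 - η) + ((p * totientWeight p)⁻¹) ^ (1 - η)) :=
    Finset.prod_nonneg fun p _ => by have := hw p; positivity
  set P := ∏ p ∈ S, eulerFactor p
  set E := ∏ p ∈ S, (1 + ((p : ℝ)⁻¹) ^ (1 - η) + ((p * totientWeight p)⁻¹) ^ (1 - η))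
  have hexp : Real.exp (((2 : ℝ) ^ J)⁻¹) ≤ 1 + 2 * ((2 : ℝ) ^ J)⁻¹ := by
    refine (Real.exp_bound_div_one_sub_of_interval hzpos.le (by linarith)).trans ?_
    rw [div_le_iff₀ (by linarith)]
    nlinarith
  have hPc : totientConst - P ≤ 2 * totientConst * t := by
    have := hP2.trans (mul_le_mul_of_nonneg_left hexp hP0)
    nlinarith [mul_le_mul hP1 htz hzpos.le hc.le]
  have ht0 : 0 ≤ t := by positivity
  have hpow : (Y * (1 + 2 * t)) ^ (1 - η) ≤ 2 * Y ^ (1 - η) := by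
    rw [Real.mul_rpow hY0.le (by positivity), mul_comm]
    refine mul_le_mul_of_nonneg_right ?_ (by positivity)
    calc (1 + 2 * t) ^ (1 - η) ≤ (2 : ℝ) ^ (1 - η) :=
          Real.rpow_le_rpow (by positivity) (by linarith) (by linarith)
      _ ≤ (2 : ℝ) ^ (1 : ℝ) := Real.rpow_le_rpow_of_exponent_le one_le_two (by linarith)
      _ = 2 := Real.rpow_one 2
  have hYpow : Y ^ (1 - η) = Y * Real.exp (-(η / 2 * Real.log x)) := by
    rw [Real.rpow_sub hY0, Real.rpow_one, Real.exp_neg, div_eq_mul_inv, Real.rpow_def_of_pos hY0,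
      hY, Real.log_sqrt hx0.le]
    congr 3
    ring
  have hYE : Y ^ (1 - η) * E ≤ Y * Real.exp (3 * ((2 : ℝ) ^ J) ^ η * (5 + 4 * Real.log J) -
      η / 2 * Real.log x) := by
    rw [hYpow, sub_eq_neg_add, Real.exp_add, mul_assoc]
    exact mul_le_mul_of_nonneg_left (mul_le_mul_of_nonneg_left hE (Real.exp_pos _).le) hY0.le
  set R := Real.exp (3 * ((2 : ℝ) ^ J) ^ η * (5 + 4 * Real.log J) - η / 2 * Real.log x)
  have hYE0 : 0 ≤ Y ^ (1 - η) * E := by positivity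
  have hYE2 : (Y * (1 + 2 * t)) ^ (1 - η) * E ≤ 2 * (Y * R) := by
    refine (mul_le_mul_of_nonneg_right hpow hE0).trans ?_
    linarith
  have hYc := mul_le_mul_of_nonneg_left hPc hY0.le
  have hYP := mul_le_mul_of_nonneg_left hP1 hY0.le
  have hYPt := mul_le_mul_of_nonneg_right hYP ht0
  have hpos : 0 ≤ Y * totientConst * t := by positivity
  have hYR : 0 ≤ Y * R := hYE0.trans hYE
  rw [abs_le]
  constructor
  · linarith [a1.1]
  · linarith [a2.2]

open Filter in
theorem exists_log_le_sqrt :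
    ∃ M₀ : ℝ, 1 ≤ M₀ ∧ ∀ M, M₀ ≤ M → 864 ≤ Real.sqrt M ∧ Real.log M ≤ Real.sqrt M / 384 := by
  have h := (isLittleO_log_rpow_atTop (by norm_num : (0 : ℝ) < 1 / 2)).bound
    (by norm_num : (0 : ℝ) < 1 / 384)
  obtain ⟨M₁, hM₁⟩ := eventually_atTop.1 h
  refine ⟨max M₁ (864 ^ 2), le_max_of_le_right (by norm_num), fun M hM => ⟨?_, ?_⟩⟩
  · exact Real.le_sqrt_of_sq_le ((le_max_right _ _).trans hM)
  · have := (Real.le_norm_self _).trans (hM₁ M ((le_max_left _ _).trans hM))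
    rw [← Real.sqrt_eq_rpow, Real.norm_of_nonneg (Real.sqrt_nonneg M)] at this
    linarith

theorem abs_multCount_sub_le_of_large {x M : ℝ} (hx0 : 0 < x)
    (hx : Real.exp 1 ≤ Real.log x)
    (hM : M = Real.sqrt (Real.log x * Real.log (Real.log x))) (hM1 : 864 ≤ Real.sqrt M)
    (hM2 : Real.log M ≤ Real.sqrt M / 384) :
    |(multCount Nat.totient x : ℝ) - totientConst * Real.sqrt x| ≤
      Real.sqrt x * ((8 * totientConst + 2) * Real.exp (-(1 / 16) * M)) := by
  have he := Real.add_one_le_exp (1 : ℝ)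
  set L := Real.log x with hL
  have hL0 : 0 < L := by linarith
  have hLL : 1 ≤ Real.log L := (Real.le_log_iff_exp_le hL0).2 hx
  have hM0 : 0 ≤ M := hM ▸ Real.sqrt_nonneg _
  have hsq := Real.sq_sqrt hM0
  set s := Real.sqrt M
  have hsM : s ≤ M / 864 := by nlinarith
  have hMbig : 746496 ≤ M := by nlinarith
  have hMpos : 0 < M := by linarith
  have hM2L : M ^ 2 = L * Real.log L := by rw [hM, Real.sq_sqrt (by positivity)]
  have hLM : L ≤ M ^ 2 := by rw [hM2L]; exact le_mul_of_one_le_right hL0.le hLL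
  have hlogM : Real.log L ≤ 2 * Real.log M := by
    have := Real.log_le_log hL0 hLM
    rwa [Real.log_pow, Nat.cast_ofNat] at this
  have hlog2 := Real.log_two_gt_d9
  have hlog2' := Real.log_two_lt_d9
  set J := ⌈M⌉₊ with hJ
  have hJM : M ≤ J := Nat.le_ceil M
  have hJM' : (J : ℝ) < M + 1 := Nat.ceil_lt_add_one hM0
  have hJ0 : 0 < J := Nat.ceil_pos.2 hMpos
  have hlogMnn : 0 ≤ Real.log M := Real.log_nonneg (by linarith)
  have hMexp : M = Real.exp (Real.log M) := (Real.exp_log hMpos).symm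
  have hpowJ : (2 : ℝ) ^ J = Real.exp (J * Real.log 2) := by
    rw [mul_comm, Real.exp_mul, Real.exp_log two_pos, Real.rpow_natCast]
  have ht : 2 * L / 2 ^ J ≤ 2 * Real.exp (-(1 / 16) * M) := by
    rw [mul_div_assoc]
    refine mul_le_mul_of_nonneg_left ?_ two_pos.le
    have h1 : L ≤ Real.exp (2 * Real.log M) := by
      rw [two_mul, Real.exp_add, ← hMexp, ← sq]
      exact hLM
    rw [hpowJ, div_le_iff₀ (Real.exp_pos _), ← Real.exp_add]
    refine h1.trans (Real.exp_le_exp.2 ?_)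
    nlinarith
  have hexp4 : Real.exp (-(1 / 16) * M) ≤ 1 / 4 := by
    have h1 := Real.add_one_le_exp (1 / 16 * M)
    rw [neg_mul, Real.exp_neg]
    exact (inv_anti₀ four_pos (by linarith)).trans (by norm_num)
  set η := Real.log M / (2 * M) with hη
  have hη0 : 0 ≤ η := by positivity
  have hη1 : η ≤ 1 := by
    rw [hη, div_le_one (by positivity)]
    linarith
  have main := abs_multCount_sub_le (x := x) (J := J) (η := η)
    ((Real.le_log_iff_exp_le hx0).1 (by linarith)) hJ0 (by linarith) hη0 hη1
  refine main.trans (mul_le_mul_of_nonneg_left ?_ (Real.sqrt_nonneg x))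
  have hc := totientConst_pos
  have e1 : ((2 : ℝ) ^ J) ^ η ≤ s := by
    have hs0 : 0 < s := by linarith
    rw [hpowJ, ← Real.exp_mul, ← Real.exp_log hs0]
    refine Real.exp_le_exp.2 ?_
    rw [Real.log_sqrt hM0, hη, ← mul_div_assoc, div_le_div_iff₀ (by positivity) two_pos]
    have : (J : ℝ) * Real.log 2 ≤ M := by nlinarith
    nlinarith [mul_le_mul_of_nonneg_right this hlogMnn]
  have e2 : Real.log J ≤ 1 + Real.log M := by
    have h1 : (J : ℝ) ≤ 2 * M := by linarith
    have h2 := Real.log_le_log (by exact_mod_cast hJ0) h1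
    rw [Real.log_mul two_ne_zero hMpos.ne'] at h2
    linarith
  have e0 : 0 ≤ Real.log J := Real.log_nonneg (by exact_mod_cast hJ0)
  have e3 : 3 * ((2 : ℝ) ^ J) ^ η * (5 + 4 * Real.log J) ≤ M / 16 := by
    calc 3 * ((2 : ℝ) ^ J) ^ η * (5 + 4 * Real.log J)
        ≤ 3 * s * (9 + 4 * Real.log M) := by
          refine mul_le_mul (by linarith) (by linarith) (by linarith) (by linarith)
      _ ≤ 3 * s * (9 + 4 * (s / 384)) :=
          mul_le_mul_of_nonneg_left (by linarith) (by linarith)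
      _ ≤ M / 16 := by nlinarith
  have e4 : M / 8 ≤ η / 2 * L := by
    rw [hη, div_div, div_mul_eq_mul_div, div_le_div_iff₀ (by norm_num) (by positivity)]
    nlinarith
  have e5 : Real.exp (3 * ((2 : ℝ) ^ J) ^ η * (5 + 4 * Real.log J) - η / 2 * L) ≤
      Real.exp (-(1 / 16) * M) := Real.exp_le_exp.2 (by linarith)
  have e6 := mul_le_mul_of_nonneg_left ht (by positivity : 0 ≤ 4 * totientConst)
  linarith

theorem multCount_le {x : ℝ} (hx : 0 ≤ x) : (multCount Nat.totient x : ℝ) ≤ x := by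
  refine le_trans ?_ (Nat.floor_le hx)
  have h : {n : ℕ | 0 < n ∧ (n : ℝ) ≤ x ∧ ∃ k : ℕ, 0 < k ∧ n = k * k.totient} ⊆
      (Finset.Ioc 0 ⌊x⌋₊ : Finset ℕ) := fun n hn =>
    Finset.mem_coe.2 (Finset.mem_Ioc.2 ⟨hn.1, Nat.le_floor hn.2.1⟩)
  have := Set.ncard_le_ncard h (Finset.finite_toSet _)
  rw [Set.ncard_coe_finset, Nat.card_Ioc, Nat.sub_zero] at this
  exact_mod_cast this

theorem theorem1p3 :
    Multipliable totientFactor ∧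
    (1.365 ≤ totientConst ∧ totientConst < 1.366) ∧
    ∃ c : ℝ, 0 < c ∧ ∃ C : ℝ, 0 < C ∧ ∀ x : ℝ, Real.exp 1 ≤ x →
      |(multCount Nat.totient x : ℝ) - totientConst * x ^ (1 / 2 : ℝ)| ≤
        C * (x ^ (1 / 2 : ℝ) *
          Real.exp (-c * Real.sqrt (Real.log x * Real.log (Real.log x)))) := by
  refine ⟨multipliable_totientFactor, totientConst_bounds, 1 / 16, by norm_num, ?_⟩
  obtain ⟨M₀, hM₀, hlarge⟩ := exists_log_le_sqrt
  have hc := totientConst_pos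
  set X := Real.exp (max (Real.exp 1) (M₀ ^ 2)) with hX
  have hX0 : 0 < X := Real.exp_pos _
  refine ⟨(8 * totientConst + 2) + (1 + totientConst) * X * Real.exp (1 / 16 * X), by positivity,
    fun x hx => ?_⟩
  rw [← Real.sqrt_eq_rpow]
  have hx0 : 0 < x := (Real.exp_pos 1).trans_le hx
  have hx1 : 1 ≤ x := (Real.one_le_exp zero_le_one).trans hx
  have hL1 : 1 ≤ Real.log x := (Real.le_log_iff_exp_le hx0).2 hx
  have hLL0 : 0 ≤ Real.log (Real.log x) := Real.log_nonneg hL1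
  set M := Real.sqrt (Real.log x * Real.log (Real.log x)) with hM
  have hs1 : 1 ≤ Real.sqrt x := Real.one_le_sqrt.2 hx1
  have hexp := Real.exp_pos (-(1 / 16) * M)
  have hsexp : 0 ≤ Real.sqrt x * Real.exp (-(1 / 16) * M) := by positivity
  by_cases hcase : Real.exp 1 ≤ Real.log x ∧ M₀ ≤ M
  · obtain ⟨h1, h2⟩ := hlarge M hcase.2
    refine (abs_multCount_sub_le_of_large hx0 hcase.1 hM h1 h2).trans ?_
    have : 0 ≤ (1 + totientConst) * X * Real.exp (1 / 16 * X) := by positivity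
    nlinarith [mul_nonneg this hsexp]
  · have hLX : Real.log x ≤ max (Real.exp 1) (M₀ ^ 2) := by
      by_contra! hlt
      obtain ⟨h1, h2⟩ := max_lt_iff.1 hlt
      refine hcase ⟨h1.le, Real.le_sqrt_of_sq_le (h2.le.trans ?_)⟩
      exact le_mul_of_one_le_right (by linarith)
        ((Real.le_log_iff_exp_le (by linarith)).2 h1.le)
    have hxX : x ≤ X := by
      rw [← Real.exp_log hx0]
      exact Real.exp_le_exp.2 hLX
    have hMX : M ≤ X := by
      refine le_trans ?_ hxX
      refine Real.sqrt_le_iff.2 ⟨hx0.le, ?_⟩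
      have h1 := Real.log_le_self hx0.le
      have h2 := Real.log_le_self (by linarith : 0 ≤ Real.log x)
      nlinarith
    have hN := multCount_le hx0.le
    have hN0 : (0 : ℝ) ≤ multCount Nat.totient x := Nat.cast_nonneg _
    have hsx : Real.sqrt x ≤ x := Real.sqrt_le_iff.2 ⟨hx0.le, by nlinarith⟩
    have h1 : |(multCount Nat.totient x : ℝ) - totientConst * Real.sqrt x| ≤
        (1 + totientConst) * X := by
      rw [abs_le]
      constructor <;> nlinarith
    have h2 : 1 ≤ Real.exp (1 / 16 * X) * (Real.sqrt x * Real.exp (-(1 / 16) * M)) := by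
      have e : 1 ≤ Real.exp (1 / 16 * X) * Real.exp (-(1 / 16) * M) := by
        rw [← Real.exp_add]
        exact Real.one_le_exp (by linarith)
      nlinarith
    have h3 := le_mul_of_one_le_right (by positivity : 0 ≤ (1 + totientConst) * X) h2
    nlinarith [mul_nonneg (by positivity : 0 ≤ 8 * totientConst + 2) hsexp]
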